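/- Formulas are built from an infinite set $\mathrm{AP}$ of atomic propositions by $\bot,\wedge,\vee,\to$; $\mathtt{IPC}$ and $\mathtt{CPC}$ are the sets of theorems of intuitionistic and of classical propositional logic. An intermediate logic is a set $L$ of formulas with $\mathtt{IPC}\subseteq L\subseteq\mathtt{CPC}$ that is closed under modus ponens and uniform substitution. Let $\chi=\chi(p)$ be a univariate formula, i.e. a formula containing no atomic proposition other than $p$. Put $\chi^0(p)=p$, $\chi^{k+1}(p)=\chi(\chi^k(p))$, and let $n$ (the index of $\chi$, which exists by Ruitenburg's theorem) be the least number with $\chi^n\leftrightarrow\chi^{n+2}\in\mathtt{IPC}$. *$\chi$-logics.* For a set $\Gamma$ of formulas, $\Gamma^\chi$ is the smallest set of formulas that contains $\mathtt{IPC}$, all substitution instances of the formulas in $\Gamma$, and $\chi^2(q)\leftrightarrow q$ for every atomic proposition $q$, and that is closed under modus ponens. $\mathbf{IL}^\chi$ is the collection of the sets $L^\chi$, $L$ an intermediate logic, ordered by inclusion. *$\chi$-varieties.* For a Heyting algebra $H$ let $\boldsymbol\chi:H\to H$ be the polynomial function $a\mapsto\chi(a)$, and let $H^\chi=\boldsymbol\chi^n[H]$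 be the $\chi$-core of $H$. A variety is a class of Heyting algebras closed under homomorphic images, subalgebras and arbitrary (also empty) products. For a variety $\mathcal V$ let $\mathcal V^\chi$ be the class of all Heyting algebras $K$ that have, up to isomorphism, a subalgebra $H\in\mathcal V$ with $H^\chi=K^\chi$. The classes $\mathcal V^\chi$ are the $\chi$-varieties; one is nontrivial if it has a member in which $0\neq1$. $\mathbf{HA}^\chi$ is the collection of nontrivial $\chi$-varieties, ordered by inclusion. *Semantics.* Write $H\vDash^\chi\varphi$ if $\varphi$ takes the value $1$ in $H$ under every valuation $\mathrm{AP}\to H$ with values in $H^\chi$. Put $\mathsf{Var}^\chi(\Gamma)=\{H : H\vDash^\chi\varphi\text{ for all }\varphi\in\Gamma\}$ and $\mathsf{Log}^\chi(\mathcal C)=\{\varphi : H\vDash^\chi\varphi\text{ for all }H\in\mathcal C\}$. **Theorem (Duality).** For every univariate formula $\chi$: 1. $\mathbf{IL}^\chi$ is a lattice, with meet $\Lambda_1\cap\Lambda_2$ and with join the closure of $\Lambda_1\cup\Lambda_2$ under modus ponens. $\mathbf{HA}^\chi$ is a lattice, with meet $\mathcal X_1\cap\mathcal X_2$ and with join the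 least member of $\mathbf{HA}^\chi$ containing $\mathcal X_1\cup\mathcal X_2$. 2. $\mathsf{Var}^\chi$ and $\mathsf{Log}^\chi$ restrict to mutually inverse, order-reversing bijections between $\mathbf{IL}^\chi$ and $\mathbf{HA}^\chi$. Hence $\mathbf{IL}^\chi\cong^{op}\mathbf{HA}^\chi$. Both parts also hold with $\mathbf{IL}^\chi$ replaced by the collection of all $\Gamma^\chi$, $\Gamma$ an arbitrary set of formulas, and $\mathbf{HA}^\chi$ replaced by the collection of all $\chi$-varieties. -/

import Mathlib

universe u v

namespace ChiLogic

/-- Propositional formulas over a type `α` of atomic propositions. -/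
inductive Formula (α : Type u) : Type u where
  | atom : α → Formula α
  | bot : Formula α
  | and : Formula α → Formula α → Formula α
  | or : Formula α → Formula α → Formula α
  | imp : Formula α → Formula α → Formula α

namespace Formula

/-- The biconditional `φ ↔ ψ`, i.e. `(φ → ψ) ∧ (ψ → φ)`. -/
def iff {α : Type u} (φ ψ : Formula α) : Formula α := (φ.imp ψ).and (ψ.imp φ)

/-- Simultaneous substitution of the formulas `σ p` for the atomic propositions `p`. -/
def subst {α : Type u} {β : Type v} (σ : α → Formula β) : Formula α → Formula β
  | atom p => σ p
  | bot => bot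
  | and φ ψ => and (φ.subst σ) (ψ.subst σ)
  | or φ ψ => or (φ.subst σ) (ψ.subst σ)
  | imp φ ψ => imp (φ.subst σ) (ψ.subst σ)

/-- The interpretation of a formula in a Heyting algebra under a valuation. -/
def interp {α : Type u} {H : Type v} [HeytingAlgebra H] (V : α → H) : Formula α → H
  | atom p => V p
  | bot => ⊥
  | and φ ψ => φ.interp V ⊓ ψ.interp V
  | or φ ψ => φ.interp V ⊔ ψ.interp V
  | imp φ ψ => φ.interp V ⇨ ψ.interp V

end Formula

/-- Derivability in a Hilbert-style axiomatisation of intuitionistic propositional calculus. -/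
inductive IPCProvable {α : Type u} : Formula α → Prop
  | axK (φ ψ : Formula α) : IPCProvable (φ.imp (ψ.imp φ))
  | axS (φ ψ θ : Formula α) :
      IPCProvable ((φ.imp (ψ.imp θ)).imp ((φ.imp ψ).imp (φ.imp θ)))
  | andLeft (φ ψ : Formula α) : IPCProvable ((φ.and ψ).imp φ)
  | andRight (φ ψ : Formula α) : IPCProvable ((φ.and ψ).imp ψ)
  | andIntro (φ ψ : Formula α) : IPCProvable (φ.imp (ψ.imp (φ.and ψ)))
  | orLeft (φ ψ : Formula α) : IPCProvable (φ.imp (φ.or ψ))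
  | orRight (φ ψ : Formula α) : IPCProvable (ψ.imp (φ.or ψ))
  | orElim (φ ψ θ : Formula α) :
      IPCProvable ((φ.imp θ).imp ((ψ.imp θ).imp ((φ.or ψ).imp θ)))
  | exFalso (φ : Formula α) : IPCProvable (Formula.bot.imp φ)
  | mp {φ ψ : Formula α} : IPCProvable φ → IPCProvable (φ.imp ψ) → IPCProvable ψ

/-- The set of theorems of intuitionistic propositional calculus. -/
def IPC (α : Type u) : Set (Formula α) := {φ | IPCProvable φ}

/-- The set of classical (two-valued) tautologies. -/
def CPC (α : Type u) : Set (Formula α) := {φ | ∀ V : α → Bool, φ.interp V = ⊤}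

/-- Intermediate logics. -/
structure IsIntermediateLogic {α : Type u} (L : Set (Formula α)) : Prop where
  ipc_subset : IPC α ⊆ L
  subset_cpc : L ⊆ CPC α
  mp : ∀ φ ψ : Formula α, φ ∈ L → φ.imp ψ ∈ L → ψ ∈ L
  subst : ∀ (φ : Formula α) (σ : α → Formula α), φ ∈ L → φ.subst σ ∈ L

/-- Membership in the closure of `Γ` under modus ponens. -/
inductive InMPClosure {α : Type u} (Γ : Set (Formula α)) : Formula α → Prop
  | base {φ : Formula α} : φ ∈ Γ → InMPClosure Γ φ
  | mp {φ ψ : Formula α} : InMPClosure Γ φ → InMPClosure Γ (φ.imp ψ) → InMPClosure Γ ψ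

/-- `MP(Γ)`: the smallest set of formulas extending `Γ` and closed under modus ponens. -/
def mpClosure {α : Type u} (Γ : Set (Formula α)) : Set (Formula α) := {φ | InMPClosure Γ φ}

/-- A univariate formula `χ(p)`: a formula whose only possible atomic proposition is the single
placeholder `p = Formula.atom ()`. -/
abbrev UnivariateFormula : Type := Formula Unit

namespace UnivariateFormula

/-- The formula `χ(ψ)`, obtained by substituting `ψ` for the single variable of `χ`. -/
def app {α : Type u} (χ : UnivariateFormula) (ψ : Formula α) : Formula α :=
  Formula.subst (fun _ => ψ) χ

/-- The iterates `χ^0(p) = p` and `χ^(n+1)(p) = χ(χ^n(p))`. -/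
def iter (χ : UnivariateFormula) : ℕ → UnivariateFormula
  | 0 => Formula.atom ()
  | n + 1 => χ.app (χ.iter n)

/-- The Ruitenburg index of `χ`: the least `n` such that `χ^n ↔ χ^(n+2)` is a theorem of
intuitionistic propositional calculus. (By Ruitenburg's theorem such an `n` always exists.) -/
noncomputable def index (χ : UnivariateFormula) : ℕ :=
  sInf {n : ℕ | (χ.iter n).iff (χ.iter (n + 2)) ∈ IPC Unit}

/-- The polynomial function `a ↦ χ(a)` on a Heyting algebra. -/
def poly (χ : UnivariateFormula) {H : Type v} [HeytingAlgebra H] (a : H) : H :=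
  Formula.interp (fun _ => a) χ

/-- The `χ`-core `H^χ = χ^n[H]` of a Heyting algebra `H`, where `n` is the index of `χ`. -/
def core (χ : UnivariateFormula) (H : Type v) [HeytingAlgebra H] : Set H :=
  (χ.poly (H := H))^[χ.index] '' Set.univ

end UnivariateFormula

/-- Membership in the `χ`-logic generated by a set `Γ` of formulas. -/
inductive InChiLogic {α : Type u} (χ : UnivariateFormula) (Γ : Set (Formula α)) :
    Formula α → Prop
  | ipc {φ : Formula α} : φ ∈ IPC α → InChiLogic χ Γ φ
  | inst {φ : Formula α} (σ : α → Formula α) : φ ∈ Γ → InChiLogic χ Γ (φ.subst σ)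
  | fixpoint (p : α) :
      InChiLogic χ Γ ((χ.app (χ.app (Formula.atom p))).iff (Formula.atom p))
  | mp {φ ψ : Formula α} : InChiLogic χ Γ φ → InChiLogic χ Γ (φ.imp ψ) → InChiLogic χ Γ ψ

/-- `Γ^χ`: the `χ`-logic generated by `Γ`, that is, the smallest set of formulas containing `IPC`,
all substitution instances of formulas in `Γ` and `χ²(p) ↔ p` for all atomic propositions `p`,
and closed under modus ponens. -/
def chiLogic {α : Type u} (χ : UnivariateFormula) (Γ : Set (Formula α)) : Set (Formula α) :=
  {φ | InChiLogic χ Γ φ}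

/-- The collection of all `χ`-logics generated by arbitrary sets of formulas (including the
inconsistent one, which consists of all formulas). -/
def AllChiLogics (α : Type u) (χ : UnivariateFormula) : Set (Set (Formula α)) :=
  {Λ | ∃ Γ : Set (Formula α), Λ = chiLogic χ Γ}

/-- The collection `IL^χ` of `χ`-variants of intermediate logics. -/
def IL (α : Type u) (χ : UnivariateFormula) : Set (Set (Formula α)) :=
  {Λ | ∃ L : Set (Formula α), IsIntermediateLogic L ∧ Λ = chiLogic χ L}

/-- Varieties: classes of Heyting algebras closed under homomorphic images, subalgebras (up to
isomorphism) and products, the empty product included. -/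
structure IsVariety (C : Set HeytAlg.{u}) : Prop where
  image : ∀ A B : HeytAlg.{u}, A ∈ C →
    (∃ f : HeytingHom A B, Function.Surjective f) → B ∈ C
  sub : ∀ A B : HeytAlg.{u}, A ∈ C →
    (∃ f : HeytingHom B A, Function.Injective f) → B ∈ C
  prod : ∀ (I : Type u) (A : I → HeytAlg.{u}), (∀ i, A i ∈ C) → HeytAlg.of (∀ i, A i) ∈ C

/-- `K` is (up to isomorphism) a core superalgebra of `H`: `H` is a subalgebra of `K` and
`H^χ = K^χ`. -/
def IsCoreSuperalgebra (χ : UnivariateFormula) (K H : HeytAlg.{u}) : Prop :=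
  ∃ f : HeytingHom H K, Function.Injective f ∧ f '' χ.core H = χ.core K

/-- The `χ`-closure `V^χ` of a class of Heyting algebras. -/
def chiClosure (χ : UnivariateFormula) (V : Set HeytAlg.{u}) : Set HeytAlg.{u} :=
  {K | ∃ H ∈ V, IsCoreSuperalgebra χ K H}

/-- The collection of all `χ`-varieties (including the one consisting of the one-element
algebras). -/
def AllChiVarieties (χ : UnivariateFormula) : Set (Set HeytAlg.{u}) :=
  {X | ∃ V : Set HeytAlg.{u}, IsVariety V ∧ X = chiClosure χ V}

/-- The collection `HA^χ` of nontrivial `χ`-varieties: those with a member in which `0 ≠ 1`. -/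
def HA (χ : UnivariateFormula) : Set (Set HeytAlg.{u}) :=
  {X | X ∈ AllChiVarieties χ ∧ ∃ H ∈ X, Nontrivial H}

/-- `H ⊨^χ φ`: the formula `φ` is true in `H` under every `χ`-valuation, i.e. every valuation with
values in the `χ`-core of `H`. -/
def ChiValid {α : Type u} (χ : UnivariateFormula) (H : Type v) [HeytingAlgebra H]
    (φ : Formula α) : Prop :=
  ∀ σ : α → H, (∀ p, σ p ∈ χ.core H) → φ.interp σ = ⊤

/-- `Var^χ(Γ)`: the class of Heyting algebras `χ`-validating all formulas in `Γ`. -/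
def chiVar {α : Type u} (χ : UnivariateFormula) (Γ : Set (Formula α)) : Set HeytAlg.{u} :=
  {H | ∀ φ ∈ Γ, ChiValid χ H φ}

/-- `Log^χ(C)`: the set of formulas `χ`-valid in all members of `C`. -/
def chiLog {α : Type u} (χ : UnivariateFormula) (C : Set HeytAlg.{u}) : Set (Formula α) :=
  {φ | ∀ H ∈ C, ChiValid χ H φ}

end ChiLogic

open ChiLogic

/-! A valuation into the `χ`-core of `K` only sees the subalgebra of `K` generated by the core, and
every element of that subalgebra is the value of a formula at core elements. So `K` `χ`-validates
all substitution instances of `Γ` exactly when this subalgebra, `coreAlg χ K`, validates `Γ` in the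
ordinary sense: Var^χ(Γ^χ) = Var(Γ)^χ (`chiVar_chiLogic`). With Birkhoff's theorem (`varOf_logOf`)
the `χ`-varieties are therefore the classes Var^χ(Γ^χ), and Var^χ undoes Log^χ on them. Conversely,
Log^χ undoes Var^χ by completeness (`chiLog_chiVar_chiLogic`): in the Lindenbaum–Tarski algebra of
Γ^χ the axioms χ²(q) ↔ q put the classes of the atoms into the core, so the canonical valuation is a
`χ`-valuation.

Both arguments need the core to be the set of fixpoints of χ² (`mem_core`), hence Ruitenburg's
theorem in one variable (`exists_iterate_poly_eq`). It follows from the four possible pairs of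
values of `χ` at ⊤ and ⊥, with the values of `χ` below aᶜᶜ settling the nontrivial cases.

Meets of `χ`-logics come from a deduction theorem (`exists_imp_mem_of_mem_chiLogic`), meets of
`χ`-varieties from the criterion `mem_chiClosure_iff`, and joins of `χ`-varieties from meets of
`χ`-logics through the duality. Intermediate logics match nontrivial varieties because the
two-element algebra validates precisely the classical tautologies and embeds in every nontrivial
Heyting algebra. -/

namespace ChiLogic

variable {α : Type u}

/-! ### Formulas, interpretations and soundness -/

namespace Formula

theorem subst_atom (φ : Formula α) : φ.subst atom = φ := by
  induction φ with
  | atom p => rfl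
  | bot => rfl
  | and φ ψ ih₁ ih₂ | or φ ψ ih₁ ih₂ | imp φ ψ ih₁ ih₂ => simp only [subst, ih₁, ih₂]

theorem interp_subst {β : Type*} {H : Type*} [HeytingAlgebra H] (V : β → H) (σ : α → Formula β)
    (φ : Formula α) : (φ.subst σ).interp V = φ.interp fun p => (σ p).interp V := by
  induction φ with
  | atom p => rfl
  | bot => rfl
  | and φ ψ ih₁ ih₂ | or φ ψ ih₁ ih₂ | imp φ ψ ih₁ ih₂ => simp only [subst, interp, ih₁, ih₂]

theorem map_interp {H K : Type*} [HeytingAlgebra H] [HeytingAlgebra K] (f : HeytingHom H K)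
    (V : α → H) (φ : Formula α) : f (φ.interp V) = φ.interp fun p => f (V p) := by
  induction φ with
  | atom p => rfl
  | bot => exact map_bot f
  | and φ ψ ih₁ ih₂ => simp only [interp, map_inf, ih₁, ih₂]
  | or φ ψ ih₁ ih₂ => simp only [interp, map_sup, ih₁, ih₂]
  | imp φ ψ ih₁ ih₂ => simp only [interp, map_himp, ih₁, ih₂]

theorem interp_iff_eq_top {H : Type*} [HeytingAlgebra H] (V : α → H) (φ ψ : Formula α) :
    (φ.iff ψ).interp V = ⊤ ↔ φ.interp V = ψ.interp V := by
  rw [le_antisymm_iff (a := φ.interp V), ← himp_eq_top_iff (a := φ.interp V),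
    ← himp_eq_top_iff (a := ψ.interp V)]
  exact inf_eq_top_iff

theorem interp_pi {I : Type*} {A : I → Type*} [∀ i, HeytingAlgebra (A i)] (V : α → ∀ i, A i)
    (φ : Formula α) (i : I) : φ.interp V i = φ.interp fun p => V p i := by
  induction φ with
  | atom p => rfl
  | bot => rfl
  | and φ ψ ih₁ ih₂ | or φ ψ ih₁ ih₂ | imp φ ψ ih₁ ih₂ =>
    simp only [interp, Pi.inf_apply, Pi.sup_apply, Pi.himp_apply, ih₁, ih₂]

/-- The atomic propositions occurring in a formula. -/
def atoms : Formula α → Set α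
  | atom p => {p}
  | bot => ∅
  | and φ ψ => φ.atoms ∪ ψ.atoms
  | or φ ψ => φ.atoms ∪ ψ.atoms
  | imp φ ψ => φ.atoms ∪ ψ.atoms

theorem finite_atoms (φ : Formula α) : φ.atoms.Finite := by
  induction φ with
  | atom p => exact Set.finite_singleton p
  | bot => exact Set.finite_empty
  | and φ ψ ih₁ ih₂ | or φ ψ ih₁ ih₂ | imp φ ψ ih₁ ih₂ => exact ih₁.union ih₂

theorem interp_congr {H : Type*} [HeytingAlgebra H] {V W : α → H} {φ : Formula α}
    (h : ∀ p ∈ φ.atoms, V p = W p) : φ.interp V = φ.interp W := by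
  induction φ with
  | atom p => exact h p rfl
  | bot => rfl
  | and φ ψ ih₁ ih₂ | or φ ψ ih₁ ih₂ | imp φ ψ ih₁ ih₂ =>
    simp only [interp, ih₁ fun p hp => h p (Or.inl hp), ih₂ fun p hp => h p (Or.inr hp)]

end Formula

open Formula

theorem IPCProvable.interp_eq_top {H : Type*} [HeytingAlgebra H] (V : α → H) {φ : Formula α}
    (h : IPCProvable φ) : φ.interp V = ⊤ := by
  induction h with
  | axK φ ψ => simp [interp]
  | axS φ ψ θ =>
    simp only [interp, himp_eq_top_iff, le_himp_iff]
    set a := φ.interp V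
    set b := ψ.interp V
    set c := θ.interp V
    have h₁ : (a ⇨ b ⇨ c) ⊓ (a ⇨ b) ⊓ a ≤ b := (inf_le_inf_right _ inf_le_right).trans himp_inf_le
    have h₂ : (a ⇨ b ⇨ c) ⊓ (a ⇨ b) ⊓ a ≤ b ⇨ c :=
      (inf_le_inf_right _ inf_le_left).trans himp_inf_le
    exact (le_inf h₂ h₁).trans himp_inf_le
  | andLeft φ ψ => simp [interp]
  | andRight φ ψ => simp [interp]
  | andIntro φ ψ => simp [interp]
  | orLeft φ ψ => simp [interp]
  | orRight φ ψ => simp [interp]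
  | orElim φ ψ θ =>
    simp only [interp, himp_eq_top_iff, le_himp_iff]
    rw [← le_himp_iff, sup_himp_distrib]
  | exFalso φ => simp [interp]
  | mp _ _ ih₁ ih₂ =>
    simp only [interp, ih₁, himp_eq_top_iff] at ih₂
    exact top_le_iff.mp ih₂

/-! ### Theories and their Lindenbaum–Tarski algebras -/

/-- Sets of formulas containing `IPC` and closed under modus ponens. -/
structure IsTheory (T : Set (Formula α)) : Prop where
  ipc : ∀ {φ}, IPCProvable φ → φ ∈ T
  mp : ∀ {φ ψ}, φ ∈ T → φ.imp ψ ∈ T → ψ ∈ T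

namespace IsTheory

variable {T : Set (Formula α)} {φ ψ θ : Formula α}

theorem imp_of_mem (hT : IsTheory T) (h : ψ ∈ T) : φ.imp ψ ∈ T :=
  hT.mp h (hT.ipc (.axK ψ φ))

theorem imp_mp (hT : IsTheory T) (h₁ : φ.imp ψ ∈ T) (h₂ : φ.imp (ψ.imp θ) ∈ T) :
    φ.imp θ ∈ T :=
  hT.mp h₁ (hT.mp h₂ (hT.ipc (.axS φ ψ θ)))

theorem imp_refl (hT : IsTheory T) (φ : Formula α) : φ.imp φ ∈ T :=
  hT.imp_mp (hT.ipc (.axK φ φ)) (hT.ipc (.axK φ (φ.imp φ)))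

theorem imp_trans (hT : IsTheory T) (h₁ : φ.imp ψ ∈ T) (h₂ : ψ.imp θ ∈ T) : φ.imp θ ∈ T :=
  hT.imp_mp h₁ (hT.imp_of_mem h₂)

theorem imp_and (hT : IsTheory T) (h₁ : φ.imp ψ ∈ T) (h₂ : φ.imp θ ∈ T) :
    φ.imp (ψ.and θ) ∈ T :=
  hT.imp_mp h₂ (hT.imp_trans h₁ (hT.ipc (.andIntro ψ θ)))

theorem or_imp (hT : IsTheory T) (h₁ : φ.imp θ ∈ T) (h₂ : ψ.imp θ ∈ T) :
    (φ.or ψ).imp θ ∈ T :=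
  hT.mp h₂ (hT.mp h₁ (hT.ipc (.orElim φ ψ θ)))

theorem imp_imp_iff (hT : IsTheory T) : φ.imp (ψ.imp θ) ∈ T ↔ (φ.and ψ).imp θ ∈ T := by
  constructor
  · intro h
    exact hT.imp_mp (hT.ipc (.andRight φ ψ)) (hT.imp_trans (hT.ipc (.andLeft φ ψ)) h)
  · intro h
    exact hT.imp_trans (hT.ipc (.andIntro φ ψ))
      (hT.mp (hT.imp_of_mem h) (hT.ipc (.axS ψ (φ.and ψ) θ)))

/-- Provable equivalence of formulas modulo a theory. -/
def setoid (hT : IsTheory T) : Setoid (Formula α) where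
  r φ ψ := φ.imp ψ ∈ T ∧ ψ.imp φ ∈ T
  iseqv :=
    { refl := fun φ => ⟨hT.imp_refl φ, hT.imp_refl φ⟩
      symm := fun h => ⟨h.2, h.1⟩
      trans := fun h₁ h₂ => ⟨hT.imp_trans h₁.1 h₂.1, hT.imp_trans h₂.2 h₁.2⟩ }

theorem and_imp_and (hT : IsTheory T) {φ' ψ' : Formula α} (h₁ : φ.imp φ' ∈ T)
    (h₂ : ψ.imp ψ' ∈ T) : (φ.and ψ).imp (φ'.and ψ') ∈ T :=
  hT.imp_and (hT.imp_trans (hT.ipc (.andLeft _ _)) h₁) (hT.imp_trans (hT.ipc (.andRight _ _)) h₂)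

theorem or_imp_or (hT : IsTheory T) {φ' ψ' : Formula α} (h₁ : φ.imp φ' ∈ T)
    (h₂ : ψ.imp ψ' ∈ T) : (φ.or ψ).imp (φ'.or ψ') ∈ T :=
  hT.or_imp (hT.imp_trans h₁ (hT.ipc (.orLeft _ _))) (hT.imp_trans h₂ (hT.ipc (.orRight _ _)))

theorem imp_imp_imp (hT : IsTheory T) {φ' ψ' : Formula α} (h₁ : φ'.imp φ ∈ T)
    (h₂ : ψ.imp ψ' ∈ T) : (φ.imp ψ).imp (φ'.imp ψ') ∈ T :=
  hT.imp_imp_iff.mpr <| hT.imp_trans (hT.imp_mp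
    (hT.imp_trans (hT.ipc (.andRight _ _)) h₁) (hT.ipc (.andLeft _ _))) h₂

/-- The Lindenbaum–Tarski algebra of a theory. -/
def Lindenbaum (hT : IsTheory T) : Type u := Quotient hT.setoid

/-- The class of a formula in the Lindenbaum–Tarski algebra. -/
def cls (hT : IsTheory T) (φ : Formula α) : hT.Lindenbaum := Quotient.mk hT.setoid φ

theorem cls_surjective (hT : IsTheory T) : Function.Surjective hT.cls := Quotient.mk_surjective

instance (hT : IsTheory T) : LE hT.Lindenbaum where
  le := Quotient.lift₂ (fun φ ψ => φ.imp ψ ∈ T) fun _ _ _ _ h₁ h₂ => propext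
    ⟨fun h => hT.imp_trans h₁.2 (hT.imp_trans h h₂.1),
      fun h => hT.imp_trans h₁.1 (hT.imp_trans h h₂.2)⟩

instance (hT : IsTheory T) : HeytingAlgebra hT.Lindenbaum where
  le_refl a := by
    obtain ⟨φ, rfl⟩ := hT.cls_surjective a
    exact hT.imp_refl φ
  le_trans a b c := by
    obtain ⟨φ, rfl⟩ := hT.cls_surjective a
    obtain ⟨ψ, rfl⟩ := hT.cls_surjective b
    obtain ⟨θ, rfl⟩ := hT.cls_surjective c
    exact hT.imp_trans
  le_antisymm a b h₁ h₂ := by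
    obtain ⟨φ, rfl⟩ := hT.cls_surjective a
    obtain ⟨ψ, rfl⟩ := hT.cls_surjective b
    exact Quotient.sound ⟨h₁, h₂⟩
  inf := Quotient.map₂ Formula.and fun _ _ h₁ _ _ h₂ =>
    ⟨hT.and_imp_and h₁.1 h₂.1, hT.and_imp_and h₁.2 h₂.2⟩
  sup := Quotient.map₂ Formula.or fun _ _ h₁ _ _ h₂ =>
    ⟨hT.or_imp_or h₁.1 h₂.1, hT.or_imp_or h₁.2 h₂.2⟩
  himp := Quotient.map₂ Formula.imp fun _ _ h₁ _ _ h₂ =>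
    ⟨hT.imp_imp_imp h₁.2 h₂.1, hT.imp_imp_imp h₁.1 h₂.2⟩
  top := hT.cls (bot.imp bot)
  bot := hT.cls bot
  compl := Quotient.map (fun φ => φ.imp bot) fun _ _ h =>
    ⟨hT.imp_imp_imp h.2 (hT.imp_refl _), hT.imp_imp_imp h.1 (hT.imp_refl _)⟩
  inf_le_left a b := by
    obtain ⟨φ, rfl⟩ := hT.cls_surjective a
    obtain ⟨ψ, rfl⟩ := hT.cls_surjective b
    exact hT.ipc (.andLeft φ ψ)
  inf_le_right a b := by
    obtain ⟨φ, rfl⟩ := hT.cls_surjective a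
    obtain ⟨ψ, rfl⟩ := hT.cls_surjective b
    exact hT.ipc (.andRight φ ψ)
  le_inf a b c := by
    obtain ⟨φ, rfl⟩ := hT.cls_surjective a
    obtain ⟨ψ, rfl⟩ := hT.cls_surjective b
    obtain ⟨θ, rfl⟩ := hT.cls_surjective c
    exact hT.imp_and
  le_sup_left a b := by
    obtain ⟨φ, rfl⟩ := hT.cls_surjective a
    obtain ⟨ψ, rfl⟩ := hT.cls_surjective b
    exact hT.ipc (.orLeft φ ψ)
  le_sup_right a b := by
    obtain ⟨φ, rfl⟩ := hT.cls_surjective a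
    obtain ⟨ψ, rfl⟩ := hT.cls_surjective b
    exact hT.ipc (.orRight φ ψ)
  sup_le a b c := by
    obtain ⟨φ, rfl⟩ := hT.cls_surjective a
    obtain ⟨ψ, rfl⟩ := hT.cls_surjective b
    obtain ⟨θ, rfl⟩ := hT.cls_surjective c
    exact hT.or_imp
  le_top a := by
    obtain ⟨φ, rfl⟩ := hT.cls_surjective a
    exact hT.imp_of_mem (hT.imp_refl bot)
  bot_le a := by
    obtain ⟨φ, rfl⟩ := hT.cls_surjective a
    exact hT.ipc (.exFalso φ)
  le_himp_iff a b c := by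
    obtain ⟨φ, rfl⟩ := hT.cls_surjective a
    obtain ⟨ψ, rfl⟩ := hT.cls_surjective b
    obtain ⟨θ, rfl⟩ := hT.cls_surjective c
    exact hT.imp_imp_iff
  himp_bot a := by
    obtain ⟨φ, rfl⟩ := hT.cls_surjective a
    rfl

theorem cls_eq_top (hT : IsTheory T) : hT.cls φ = ⊤ ↔ φ ∈ T := by
  rw [← top_le_iff]
  change (bot.imp bot).imp φ ∈ T ↔ φ ∈ T
  exact ⟨hT.mp (hT.imp_refl bot), hT.imp_of_mem⟩

theorem interp_cls (hT : IsTheory T) {β : Type v} (σ : β → Formula α) (φ : Formula β) :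
    φ.interp (fun p => hT.cls (σ p)) = hT.cls (φ.subst σ) := by
  induction φ with
  | atom p => rfl
  | bot => rfl
  | and φ ψ ih₁ ih₂ | or φ ψ ih₁ ih₂ | imp φ ψ ih₁ ih₂ =>
    simp only [interp, ih₁, ih₂]
    rfl

theorem interp_cls_atom (hT : IsTheory T) (φ : Formula α) :
    φ.interp (fun p => hT.cls (atom p)) = hT.cls φ := by
  rw [interp_cls, subst_atom]

theorem isTheory_ipc : IsTheory (IPC α) := ⟨fun h => h, .mp⟩

/-- The homomorphism from a Lindenbaum–Tarski algebra induced by a valuation that validates the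
theory. -/
def lift (hT : IsTheory T) {H : Type v} [HeytingAlgebra H] (V : α → H)
    (hV : ∀ φ ∈ T, φ.interp V = ⊤) : HeytingHom hT.Lindenbaum H where
  toFun := Quotient.lift (fun φ => φ.interp V) fun _ _ h =>
    le_antisymm (himp_eq_top_iff.mp (hV _ h.1)) (himp_eq_top_iff.mp (hV _ h.2))
  map_sup' a b := by
    obtain ⟨φ, rfl⟩ := hT.cls_surjective a
    obtain ⟨ψ, rfl⟩ := hT.cls_surjective b
    rfl
  map_inf' a b := by
    obtain ⟨φ, rfl⟩ := hT.cls_surjective a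
    obtain ⟨ψ, rfl⟩ := hT.cls_surjective b
    rfl
  map_bot' := rfl
  map_himp' a b := by
    obtain ⟨φ, rfl⟩ := hT.cls_surjective a
    obtain ⟨ψ, rfl⟩ := hT.cls_surjective b
    rfl

theorem lift_cls (hT : IsTheory T) {H : Type v} [HeytingAlgebra H] (V : α → H)
    (hV : ∀ φ ∈ T, φ.interp V = ⊤) (φ : Formula α) : hT.lift V hV (hT.cls φ) = φ.interp V := rfl

theorem lift_injective (hT : IsTheory T) {H : Type v} [HeytingAlgebra H] (V : α → H)
    (hV : ∀ φ ∈ T, φ.interp V = ⊤) (h : ∀ φ, φ.interp V = ⊤ → φ ∈ T) :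
    Function.Injective (hT.lift V hV) := by
  intro a b hab
  obtain ⟨φ, rfl⟩ := hT.cls_surjective a
  obtain ⟨ψ, rfl⟩ := hT.cls_surjective b
  rw [lift_cls, lift_cls] at hab
  exact Quotient.sound ⟨h _ (himp_eq_top_iff.mpr hab.le), h _ (himp_eq_top_iff.mpr hab.ge)⟩

end IsTheory

/-! ### Algebras generated by a valuation -/

/-- The formulas true under a valuation form a theory. -/
theorem isTheory_interp {H : Type v} [HeytingAlgebra H] (V : α → H) :
    IsTheory {φ : Formula α | φ.interp V = ⊤} where
  ipc h := h.interp_eq_top V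
  mp {φ ψ} h₁ h₂ := by
    have h : φ.interp V ⇨ ψ.interp V = ⊤ := h₂
    rw [show φ.interp V = ⊤ from h₁, top_himp] at h
    exact h

/-- The Heyting algebra generated by the values of `V`, as a quotient of the formula algebra. -/
abbrev Generated {H : Type v} [HeytingAlgebra H] (V : α → H) : Type u :=
  (isTheory_interp V).Lindenbaum

namespace Generated

variable {H : Type v} [HeytingAlgebra H]

/-- The class of a formula in the algebra generated by `V`. -/
abbrev cls (V : α → H) (φ : Formula α) : Generated V := (isTheory_interp V).cls φ

/-- The inclusion of the algebra generated by `V`. -/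
def incl (V : α → H) : HeytingHom (Generated V) H := (isTheory_interp V).lift V fun _ h => h

theorem incl_cls (V : α → H) (φ : Formula α) : incl V (cls V φ) = φ.interp V := rfl

theorem incl_injective (V : α → H) : Function.Injective (incl V) :=
  (isTheory_interp V).lift_injective V _ fun _ h => h

/-- Transport of a generated algebra along valuations with the same theory. -/
theorem exists_injective {K : Type*} [HeytingAlgebra K] (V : α → H) (W : α → K)
    (h : ∀ φ : Formula α, φ.interp V = ⊤ ↔ φ.interp W = ⊤) :
    ∃ f : HeytingHom (Generated V) K, Function.Injective f :=
  ⟨(isTheory_interp V).lift W fun φ => (h φ).mp,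
    (isTheory_interp V).lift_injective W _ fun φ => (h φ).mpr⟩

end Generated

/-- The homomorphism from the two-element algebra. -/
def ofBool (H : Type v) [HeytingAlgebra H] : HeytingHom Bool H where
  toFun b := if b then ⊤ else ⊥
  map_sup' a b := by cases a <;> cases b <;> simp
  map_inf' a b := by cases a <;> cases b <;> simp
  map_bot' := by simp
  map_himp' a b := by cases a <;> cases b <;> simp

theorem ofBool_true (H : Type v) [HeytingAlgebra H] : ofBool H true = ⊤ := rfl

theorem ofBool_false (H : Type v) [HeytingAlgebra H] : ofBool H false = ⊥ := rfl

theorem ofBool_injective (H : Type v) [HeytingAlgebra H] [Nontrivial H] :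
    Function.Injective (ofBool H) := by
  intro a b h
  cases a <;> cases b <;> first | rfl | simp [ofBool_true, ofBool_false] at h

/-! ### Ruitenburg's theorem for univariate formulas -/

namespace UnivariateFormula

variable (χ : UnivariateFormula)

theorem map_poly {H K : Type*} [HeytingAlgebra H] [HeytingAlgebra K] (f : HeytingHom H K)
    (a : H) : f (χ.poly a) = χ.poly (f a) := map_interp f _ χ

theorem interp_app {H : Type*} [HeytingAlgebra H] (V : α → H) (φ : Formula α) :
    (χ.app φ).interp V = χ.poly (φ.interp V) := interp_subst V _ χ

theorem interp_iter {H : Type*} [HeytingAlgebra H] (a : H) (n : ℕ) :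
    (χ.iter n).interp (fun _ => a) = χ.poly^[n] a := by
  induction n with
  | zero => rfl
  | succ n ih => rw [iter, interp_app, ih, Function.iterate_succ_apply']

/-- For fixed `c`, the relation c ⊓ x = c ⊓ y is a Heyting congruence, so polynomials respect it. -/
theorem inf_poly_congr {H : Type*} [HeytingAlgebra H] {a b c : H} (h : c ⊓ a = c ⊓ b) :
    c ⊓ χ.poly a = c ⊓ χ.poly b := by
  have himp_le {x x' y y' : H} (hx : c ⊓ x = c ⊓ x') (hy : c ⊓ y = c ⊓ y') :
      c ⊓ (x ⇨ y) ≤ c ⊓ (x' ⇨ y') := by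
    refine le_inf inf_le_left (le_himp_iff.mpr ?_)
    have h₁ : c ⊓ (x ⇨ y) ⊓ x' ≤ c ⊓ x :=
      hx ▸ inf_le_inf_right _ inf_le_left
    have h₂ : c ⊓ (x ⇨ y) ⊓ x' ≤ y :=
      (le_inf (inf_le_left.trans inf_le_right) (h₁.trans inf_le_right)).trans himp_inf_le
    exact (le_inf (h₁.trans inf_le_left) h₂).trans (hy.trans_le inf_le_right)
  induction χ with
  | atom p => exact h
  | bot => rfl
  | and φ ψ ih₁ ih₂ =>
    change c ⊓ (poly φ a ⊓ poly ψ a) = c ⊓ (poly φ b ⊓ poly ψ b)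
    rw [inf_inf_distrib_left, ih₁, ih₂, ← inf_inf_distrib_left]
  | or φ ψ ih₁ ih₂ =>
    change c ⊓ (poly φ a ⊔ poly ψ a) = c ⊓ (poly φ b ⊔ poly ψ b)
    rw [inf_sup_left, ih₁, ih₂, ← inf_sup_left]
  | imp φ ψ ih₁ ih₂ => exact (himp_le ih₁ ih₂).antisymm (himp_le ih₁.symm ih₂.symm)

/-- The value is computed in `Bool` and transported along `ofBool`, so the same alternative holds in
all algebras at once. -/
theorem poly_bot_or_top (b : Bool) :
    (∀ (H : Type v) [HeytingAlgebra H], χ.poly (ofBool H b) = ⊥) ∨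
      ∀ (H : Type v) [HeytingAlgebra H], χ.poly (ofBool H b) = ⊤ := by
  simp only [← map_poly]
  cases χ.poly b
  · exact Or.inl fun H _ => rfl
  · exact Or.inr fun H _ => rfl

/-- Below `aᶜᶜ`, a univariate formula takes one of the values `⊥`, `a`, `aᶜᶜ`. -/
theorem inf_compl_compl_trichotomy :
    (∀ (H : Type v) [HeytingAlgebra H] (a : H), aᶜᶜ ⊓ χ.poly a = ⊥) ∨
    (∀ (H : Type v) [HeytingAlgebra H] (a : H), aᶜᶜ ⊓ χ.poly a = a) ∨
      ∀ (H : Type v) [HeytingAlgebra H] (a : H), aᶜᶜ ⊓ χ.poly a = aᶜᶜ := by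
  have himp {H : Type v} [HeytingAlgebra H] (c x y : H) :
      c ⊓ (x ⇨ y) = c ⊓ (c ⊓ x ⇨ c ⊓ y) := by
    apply le_antisymm
    · refine le_inf inf_le_left (le_himp_iff.mpr (le_inf (inf_le_left.trans inf_le_left) ?_))
      exact (inf_le_inf inf_le_right inf_le_right).trans himp_inf_le
    · refine le_inf inf_le_left (le_himp_iff.mpr ?_)
      refine (le_inf (inf_le_left.trans inf_le_right) (inf_le_inf_right _ inf_le_left)).trans ?_
      exact himp_inf_le.trans inf_le_right
  -- The triple ⊥, a, aᶜᶜ is closed under meet, join and implication relativised to aᶜᶜ, and the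
  -- table of these operations does not depend on the algebra.
  induction χ with
  | atom p => exact Or.inr (Or.inl fun H _ a => inf_eq_right.mpr le_compl_compl)
  | bot => exact Or.inl fun H _ a => inf_bot_eq _
  | and φ ψ ih₁ ih₂ =>
    have key (H : Type v) [HeytingAlgebra H] (a : H) :
        aᶜᶜ ⊓ poly (φ.and ψ) a = (aᶜᶜ ⊓ poly φ a) ⊓ (aᶜᶜ ⊓ poly ψ a) :=
      inf_inf_distrib_left _ _ _
    rcases ih₁ with h₁ | h₁ | h₁ <;> rcases ih₂ with h₂ | h₂ | h₂ <;>
      simp [key, h₁, h₂, le_compl_compl]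
  | or φ ψ ih₁ ih₂ =>
    have key (H : Type v) [HeytingAlgebra H] (a : H) :
        aᶜᶜ ⊓ poly (φ.or ψ) a = (aᶜᶜ ⊓ poly φ a) ⊔ (aᶜᶜ ⊓ poly ψ a) :=
      inf_sup_left _ _ _
    rcases ih₁ with h₁ | h₁ | h₁ <;> rcases ih₂ with h₂ | h₂ | h₂ <;>
      simp [key, h₁, h₂, le_compl_compl]
  | imp φ ψ ih₁ ih₂ =>
    have key (H : Type v) [HeytingAlgebra H] (a : H) :
        aᶜᶜ ⊓ poly (φ.imp ψ) a = aᶜᶜ ⊓ ((aᶜᶜ ⊓ poly φ a) ⇨ (aᶜᶜ ⊓ poly ψ a)) :=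
      himp _ _ _
    have h₀ (H : Type v) [HeytingAlgebra H] (a : H) : aᶜᶜ ⊓ aᶜ = ⊥ := compl_inf_self aᶜ
    have h₁ (H : Type v) [HeytingAlgebra H] (a : H) : aᶜᶜ ⊓ a = a := inf_eq_right.mpr le_compl_compl
    have h₂ (H : Type v) [HeytingAlgebra H] (a : H) : a ⇨ aᶜᶜ = ⊤ :=
      himp_eq_top_iff.mpr le_compl_compl
    rcases ih₁ with h₃ | h₃ | h₃ <;> rcases ih₂ with h₄ | h₄ | h₄
    · exact Or.inr <| Or.inr fun H _ a => by rw [key, h₃, h₄, himp_self, inf_top_eq]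
    · exact Or.inr <| Or.inr fun H _ a => by rw [key, h₃, bot_himp, inf_top_eq]
    · exact Or.inr <| Or.inr fun H _ a => by rw [key, h₃, bot_himp, inf_top_eq]
    · exact Or.inl fun H _ a => by rw [key, h₃, h₄, himp_bot, h₀]
    · exact Or.inr <| Or.inr fun H _ a => by rw [key, h₃, h₄, himp_self, inf_top_eq]
    · exact Or.inr <| Or.inr fun H _ a => by rw [key, h₃, h₄, h₂, inf_top_eq]
    · exact Or.inl fun H _ a => by rw [key, h₃, h₄, himp_bot, inf_compl_self]
    · exact Or.inr <| Or.inl fun H _ a => by rw [key, h₃, h₄, inf_himp, h₁]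
    · exact Or.inr <| Or.inr fun H _ a => by rw [key, h₃, h₄, himp_self, inf_top_eq]

/-- Modulo `a` the argument may be replaced by ⊤, modulo aᶜ by ⊥; this bounds `χ(a)` in terms of the
constants χ(⊤) and χ(⊥), each of which is ⊥ or ⊤. -/
theorem exists_iterate_poly_eq :
    ∃ n : ℕ, ∀ (H : Type v) [HeytingAlgebra H] (a : H),
      χ.poly^[n] a = χ.poly^[n + 2] a := by
  have htop (H : Type v) [HeytingAlgebra H] (a : H) : a ⊓ χ.poly a = a ⊓ χ.poly ⊤ :=
    χ.inf_poly_congr (by simp)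
  have hbot (H : Type v) [HeytingAlgebra H] (a : H) : aᶜ ⊓ χ.poly a = aᶜ ⊓ χ.poly ⊥ :=
    χ.inf_poly_congr (by simp)
  have const {f : ∀ (H : Type v) [HeytingAlgebra H], H} {n : ℕ}
      (h : ∀ (H : Type v) [HeytingAlgebra H] (a : H), χ.poly^[n] a = f H) :
      ∃ n : ℕ, ∀ (H : Type v) [HeytingAlgebra H] (a : H), χ.poly^[n] a = χ.poly^[n + 2] a :=
    ⟨n, fun H _ a => by rw [Function.iterate_add_apply, h, h]⟩
  rcases poly_bot_or_top.{v} χ true with h₁ | h₁ <;> simp only [ofBool_true] at h₁ <;>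
    rcases poly_bot_or_top.{v} χ false with h₂ | h₂ <;> simp only [ofBool_false] at h₂ <;>
    simp only [h₁, h₂, inf_bot_eq, inf_top_eq] at htop hbot
  -- χ(a) lies below aᶜ and is disjoint from it, so χ vanishes.
  · refine const (f := fun H _ => ⊥) (n := 1) fun H _ a => ?_
    have h := le_compl_iff_disjoint_left.mpr (disjoint_iff.mpr (htop H a))
    rw [Function.iterate_one, ← inf_eq_right.mpr h, hbot]
  · have h (H : Type v) [HeytingAlgebra H] (a : H) : χ.poly a = aᶜ := by
      have h := le_compl_iff_disjoint_left.mpr (disjoint_iff.mpr (htop H a))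
      rw [← inf_eq_right.mpr h, hbot]
    exact ⟨1, fun H _ a => by simp [h]⟩
  -- Here χ(a) ≤ aᶜᶜ, so the trichotomy determines χ(a) itself.
  · have h (H : Type v) [HeytingAlgebra H] (a : H) : aᶜᶜ ⊓ χ.poly a = χ.poly a :=
      inf_eq_right.mpr (le_compl_iff_disjoint_left.mpr (disjoint_iff.mpr (hbot H a)))
    have h₃ := inf_compl_compl_trichotomy.{v} χ
    simp only [h] at h₃
    rcases h₃ with h₃ | h₃ | h₃
    · exact const (f := fun H _ => ⊥) (n := 1) fun H _ a => h₃ H a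
    · exact ⟨0, fun H _ a => by simp [h₃]⟩
    · exact ⟨1, fun H _ a => by simp [h₃]⟩
  -- Here χ(a) lies above both a and aᶜ, hence is dense; the trichotomy at χ(a) in place of a then
  -- determines χ²(a).
  · have h (H : Type v) [HeytingAlgebra H] (a : H) : (χ.poly a)ᶜᶜ = ⊤ := by
      have h : (χ.poly a)ᶜ ≤ ⊥ := by
        rw [← compl_inf_self aᶜ]
        exact le_inf (compl_le_compl (inf_eq_left.mp (hbot H a)))
          (compl_le_compl (inf_eq_left.mp (htop H a)))
      rw [le_bot_iff.mp h, compl_bot]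
    rcases inf_compl_compl_trichotomy.{v} χ with h₃ | h₃ | h₃
    · refine const (f := fun H _ => ⊥) (n := 2) fun H _ a => ?_
      simpa [h] using h₃ H (χ.poly a)
    · have h₄ (H : Type v) [HeytingAlgebra H] (a : H) : χ.poly (χ.poly a) = χ.poly a := by
        simpa [h] using h₃ H (χ.poly a)
      exact ⟨1, fun H _ a => by simp [h₄]⟩
    · refine const (f := fun H _ => ⊤) (n := 2) fun H _ a => ?_
      simpa [h] using h₃ H (χ.poly a)

theorem iterate_index {H : Type v} [HeytingAlgebra H] (a : H) :
    χ.poly^[χ.index] a = χ.poly^[χ.index + 2] a := by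
  -- The infimum defining the index is attained only if this set is nonempty. The semantic bound
  -- becomes provability in the Lindenbaum–Tarski algebra of `IPC`; soundness then carries it to
  -- algebras in every universe.
  have hne : {n : ℕ | (χ.iter n).iff (χ.iter (n + 2)) ∈ IPC Unit}.Nonempty := by
    obtain ⟨n, hn⟩ := exists_iterate_poly_eq.{0} χ
    refine ⟨n, (IsTheory.isTheory_ipc (α := Unit)).cls_eq_top.mp ?_⟩
    rw [← IsTheory.interp_cls_atom, interp_iff_eq_top]
    rw [show (fun p => IsTheory.isTheory_ipc.cls (atom p)) =
      fun _ : Unit => IsTheory.isTheory_ipc.cls (atom ()) from rfl, interp_iter, interp_iter]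
    exact hn _ _
  have h := IPCProvable.interp_eq_top (fun _ => a) (Nat.sInf_mem hne)
  rw [interp_iff_eq_top, interp_iter, interp_iter] at h
  exact h

/-- The `χ`-core consists of the fixpoints of `χ²`. -/
theorem mem_core {H : Type v} [HeytingAlgebra H] {a : H} :
    a ∈ χ.core H ↔ χ.poly (χ.poly a) = a := by
  rw [core, Set.image_univ]
  constructor
  · rintro ⟨b, rfl⟩
    rw [← Function.iterate_succ_apply' χ.poly, ← Function.iterate_succ_apply' χ.poly]
    exact (χ.iterate_index b).symm
  · intro h
    have h' (k : ℕ) : χ.poly^[2 * k] a = a := by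
      rw [Function.iterate_mul]
      exact Function.iterate_fixed h k
    -- Another χ^n gives χ^(2n)(a), which is a because χ² fixes a.
    refine ⟨χ.poly^[χ.index] a, ?_⟩
    rw [← Function.iterate_add_apply, ← two_mul, h']

theorem map_mem_core {H K : Type*} [HeytingAlgebra H] [HeytingAlgebra K] (f : HeytingHom H K)
    {a : H} (h : a ∈ χ.core H) : f a ∈ χ.core K := by
  rw [mem_core] at h ⊢
  rw [← map_poly, ← map_poly, h]

theorem map_mem_core_iff {H K : Type*} [HeytingAlgebra H] [HeytingAlgebra K]
    {f : HeytingHom H K} (hf : Function.Injective f) {a : H} :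
    f a ∈ χ.core K ↔ a ∈ χ.core H := by
  rw [mem_core, mem_core, ← map_poly, ← map_poly, hf.eq_iff]

theorem core_nonempty (H : Type v) [HeytingAlgebra H] : (χ.core H).Nonempty :=
  ⟨_, ⊥, trivial, rfl⟩

end UnivariateFormula
end ChiLogic

namespace ChiLogic
variable {α : Type u}
open Formula

/-! ### Varieties of Heyting algebras -/

/-- The class of Heyting algebras validating all formulas in `Γ`. -/
def varOf (Γ : Set (Formula α)) : Set HeytAlg.{v} :=
  {H | ∀ φ ∈ Γ, ∀ V : α → H, φ.interp V = ⊤}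

/-- The set of formulas valid in all members of `C`. -/
def logOf (α : Type u) (C : Set HeytAlg.{v}) : Set (Formula α) :=
  {φ | ∀ H ∈ C, ∀ V : α → H, φ.interp V = ⊤}

/-- Theories closed under uniform substitution. -/
structure IsLogic (L : Set (Formula α)) : Prop extends IsTheory L where
  subst : ∀ (φ : Formula α) (σ : α → Formula α), φ ∈ L → φ.subst σ ∈ L

theorem isLogic_logOf (C : Set HeytAlg.{v}) : IsLogic (logOf α C) where
  ipc h _ _ V := h.interp_eq_top V
  mp h₁ h₂ H hH V := (isTheory_interp V).mp (h₁ H hH V) (h₂ H hH V)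
  subst φ σ h H hH V := by
    rw [interp_subst]
    exact h H hH _

theorem isVariety_varOf (Γ : Set (Formula α)) : IsVariety (varOf Γ : Set HeytAlg.{v}) where
  image A B hA := by
    rintro ⟨f, hf⟩ φ hφ V
    obtain ⟨g, hg⟩ := hf.hasRightInverse
    rw [← funext fun p => hg (V p), ← map_interp, hA φ hφ, map_top]
  sub A B hA := by
    rintro ⟨f, hf⟩ φ hφ V
    apply hf
    rw [map_interp, hA φ hφ, map_top]
  prod I A hA φ hφ V := by
    funext i
    exact (interp_pi V φ i).trans (hA i φ hφ _)

theorem subset_logOf_varOf (Γ : Set (Formula α)) : Γ ⊆ logOf α (varOf Γ : Set HeytAlg.{v}) :=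
  fun φ hφ _ hH => hH φ hφ

theorem subset_varOf_logOf (C : Set HeytAlg.{v}) : C ⊆ varOf (logOf α C) :=
  fun H hH _ hφ => hφ H hH

theorem varOf_logOf_varOf (Γ : Set (Formula α)) :
    (varOf (logOf α (varOf Γ : Set HeytAlg.{v})) : Set HeytAlg.{v}) = varOf Γ :=
  Set.Subset.antisymm (fun _ hH φ hφ => hH φ (subset_logOf_varOf Γ hφ)) (subset_varOf_logOf _)

/-- This renames the finitely many atoms of a formula over `β` into `α` and back; every use of the
infinitude of `α` passes through it. -/
theorem exists_leftInvOn_of_finite [Infinite α] {β : Type v} [Nonempty β] {D : Set β}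
    (hD : D.Finite) : ∃ (τ : α → β) (r : β → α), ∀ d ∈ D, τ (r d) = d := by
  obtain ⟨r, -, hr⟩ := hD.exists_injOn_of_encard_le (t := (Set.univ : Set α))
    (by rw [Set.encard_univ, ENat.card_eq_top_of_infinite]; exact le_top)
  exact ⟨Function.invFunOn r D, r, hr.leftInvOn_invFunOn⟩

/-- Birkhoff's theorem for varieties of Heyting algebras. -/
theorem varOf_logOf [Infinite α] {C : Set HeytAlg.{v}} (hC : IsVariety C) :
    varOf (logOf α C) = C := by
  refine Set.Subset.antisymm (fun H hH => ?_) (subset_varOf_logOf C)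
  -- With the elements of `H` as atoms, the Lindenbaum–Tarski algebra of the logic of `C` maps onto
  -- `H`. It also embeds in a product of members of `C`, one refuting each nontheorem.
  have hT := (isLogic_logOf (α := H) C).toIsTheory
  have hid : ∀ φ ∈ logOf H C, φ.interp (id : H → H) = ⊤ := by
    intro φ hφ
    have : Nonempty H := ⟨⊥⟩
    obtain ⟨τ, r, h⟩ := exists_leftInvOn_of_finite (α := α) φ.finite_atoms
    rw [← interp_congr (V := fun p => τ (r p)) (W := id) fun p hp => h p hp]
    have := hH (φ.subst fun p => atom (r p)) (fun K hK V => by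
      rw [interp_subst]
      exact hφ K hK _) τ
    rwa [interp_subst] at this
  have hne (i : {φ : Formula H // φ ∉ logOf H C}) :
      ∃ A ∈ C, ∃ V : H → A, i.1.interp V ≠ ⊤ := by
    simpa [logOf] using i.2
  choose A hA V hV using hne
  refine hC.image (HeytAlg.of hT.Lindenbaum) H (hC.sub (HeytAlg.of (∀ i, A i)) _ (hC.prod _ A hA)
    ⟨hT.lift (fun p i => V i p) fun φ hφ => ?_, hT.lift_injective _ _ fun φ hφ => ?_⟩)
    ⟨hT.lift id hid, fun a => ⟨hT.cls (atom a), rfl⟩⟩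
  · funext i
    exact (interp_pi _ φ i).trans (hφ _ (hA i) _)
  · by_contra hn
    exact hV ⟨φ, hn⟩ ((interp_pi _ φ _).symm.trans (congrFun hφ ⟨φ, hn⟩))

/-! ### The two-element algebra -/

theorem mem_cpc_of_interp_eq_top {H : Type v} [HeytingAlgebra H] [Nontrivial H] {φ : Formula α}
    (h : ∀ V : α → H, φ.interp V = ⊤) : φ ∈ CPC α := fun V => by
  apply ofBool_injective H
  rw [map_interp, h, map_top]

/-- A two-element Heyting algebra in an arbitrary universe. -/
def twoAlg : HeytAlg.{v} := HeytAlg.of (Generated fun _ : PUnit.{v + 1} => (⊥ : Bool))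

theorem exists_twoAlg_injective_bool :
    ∃ f : HeytingHom twoAlg.{v} Bool, Function.Injective f :=
  ⟨_, Generated.incl_injective _⟩

instance : Nontrivial twoAlg.{v} := by
  obtain ⟨f, -⟩ := exists_twoAlg_injective_bool.{v}
  refine ⟨⊥, ⊤, fun h => ?_⟩
  simpa using congrArg f h

theorem exists_twoAlg_injective (H : Type u) [HeytingAlgebra H] [Nontrivial H] :
    ∃ f : HeytingHom twoAlg.{v} H, Function.Injective f :=
  Generated.exists_injective _ (fun _ => ofBool H ⊥) fun φ => by
    rw [← map_interp, ← map_top (ofBool H), (ofBool_injective H).eq_iff]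

theorem twoAlg_mem_varOf {Γ : Set (Formula α)} (hΓ : Γ ⊆ CPC α) : twoAlg.{v} ∈ varOf Γ := by
  intro φ hφ V
  obtain ⟨f, hf⟩ := exists_twoAlg_injective_bool.{v}
  apply hf
  rw [map_interp, hΓ hφ, map_top]

theorem logOf_varOf_subset_cpc {Γ : Set (Formula α)} (hΓ : Γ ⊆ CPC α) :
    logOf α (varOf Γ : Set HeytAlg.{v}) ⊆ CPC α :=
  fun _ hφ => mem_cpc_of_interp_eq_top (hφ twoAlg.{v} (twoAlg_mem_varOf hΓ))

/-! ### Cores and `χ`-closures -/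

variable {χ : UnivariateFormula}

/-- The subalgebra generated by the `χ`-core. -/
abbrev coreAlg (χ : UnivariateFormula) (H : HeytAlg.{v}) : HeytAlg.{v} :=
  HeytAlg.of (Generated (Subtype.val : χ.core H → H))

theorem isCoreSuperalgebra_coreAlg (χ : UnivariateFormula) (K : HeytAlg.{v}) :
    IsCoreSuperalgebra χ K (coreAlg χ K) := by
  have hinj := Generated.incl_injective (Subtype.val : χ.core K → K)
  refine ⟨Generated.incl _, hinj, Set.Subset.antisymm ?_ fun a ha => ?_⟩
  · rintro _ ⟨a, ha, rfl⟩
    exact χ.map_mem_core _ ha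
  · exact ⟨Generated.cls _ (atom ⟨a, ha⟩), (χ.map_mem_core_iff hinj).mp ha, rfl⟩

/-- Any witness for `K` contains a copy of the core, hence of the subalgebra the core generates, and
varieties are closed under subalgebras. One canonical witness thus serves all varieties. -/
theorem mem_chiClosure_iff {C : Set HeytAlg.{v}} (hC : IsVariety C) {K : HeytAlg.{v}} :
    K ∈ chiClosure χ C ↔ coreAlg χ K ∈ C := by
  refine ⟨?_, fun h => ⟨_, h, isCoreSuperalgebra_coreAlg χ K⟩⟩
  rintro ⟨H, hH, f, hf, hcore⟩
  have (a : χ.core K) : ∃ b : H, f b = a := by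
    have ha : (a : K) ∈ f '' χ.core H := hcore.symm ▸ a.2
    obtain ⟨b, -, hb⟩ := ha
    exact ⟨b, hb⟩
  choose g hg using this
  refine hC.sub H _ hH (Generated.exists_injective _ g fun φ => ?_)
  rw [← map_top f, ← funext hg, ← map_interp, hf.eq_iff]

theorem subset_chiClosure (χ : UnivariateFormula) (C : Set HeytAlg.{v}) : C ⊆ chiClosure χ C :=
  fun H hH => ⟨H, hH, HeytingHom.id _, Function.injective_id, Set.image_id _⟩

theorem isTheory_chiLogic (χ : UnivariateFormula) (Γ : Set (Formula α)) :
    IsTheory (chiLogic χ Γ) :=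
  ⟨.ipc, .mp⟩

theorem mem_chiVar_chiLogic {Γ : Set (Formula α)} {H : HeytAlg.{u}} :
    H ∈ chiVar χ (chiLogic χ Γ) ↔ ∀ φ ∈ Γ, ∀ σ : α → Formula α, ChiValid χ H (φ.subst σ) := by
  refine ⟨fun h φ hφ σ => h _ (.inst σ hφ), fun h φ hφ V hV => ?_⟩
  induction hφ with
  | ipc h => exact IPCProvable.interp_eq_top V h
  | inst σ hφ => exact h _ hφ σ V hV
  | fixpoint p =>
    rw [interp_iff_eq_top, UnivariateFormula.interp_app, UnivariateFormula.interp_app]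
    exact χ.mem_core.mp (hV p)
  | mp _ _ ih₁ ih₂ => exact (isTheory_interp V).mp ih₁ ih₂

theorem chiVar_chiLogic [Infinite α] (Γ : Set (Formula α)) :
    chiVar χ (chiLogic χ Γ) = chiClosure χ (varOf Γ : Set HeytAlg.{u}) := by
  ext K
  rw [mem_chiVar_chiLogic, mem_chiClosure_iff (isVariety_varOf Γ)]
  constructor
  · intro h φ hφ V
    -- Each value of `V` is given by a formula over core elements. Renaming the finitely many core
    -- elements involved into `α` turns these formulas into a substitution and a `χ`-valuation.
    choose ψ hψ using fun p => (isTheory_interp (Subtype.val : χ.core K → K)).cls_surjective (V p)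
    have : Nonempty (χ.core K) := (χ.core_nonempty K).to_subtype
    obtain ⟨τ, r, hr⟩ := exists_leftInvOn_of_finite (α := α)
      (φ.finite_atoms.biUnion fun p _ => (ψ p).finite_atoms)
    apply Generated.incl_injective (Subtype.val : χ.core K → K)
    rw [map_interp, map_top]
    refine Eq.trans ?_ (h φ hφ (fun p => (ψ p).subst fun a => atom (r a))
      (fun p => (τ p : K)) fun p => (τ p).2)
    rw [interp_subst]
    refine interp_congr fun p hp => ?_
    rw [interp_subst, ← hψ, ← Generated.cls, Generated.incl_cls]
    refine interp_congr fun a ha => ?_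
    exact congrArg Subtype.val (hr a (Set.mem_biUnion hp ha)).symm
  -- A `χ`-valuation factors through the subalgebra generated by the core.
  · intro h φ hφ σ V hV
    have hV' : V = fun p => Generated.incl (Subtype.val : χ.core K → K)
        (Generated.cls _ (atom ⟨V p, hV p⟩)) := rfl
    rw [hV', ← map_interp, interp_subst]
    exact (congrArg _ (h φ hφ _)).trans (map_top _)

theorem chiLog_chiVar_chiLogic (Γ : Set (Formula α)) :
    chiLog χ (chiVar χ (chiLogic χ Γ) : Set HeytAlg.{u}) = chiLogic χ Γ := by
  refine Set.Subset.antisymm (fun φ hφ => ?_) fun φ hφ H hH => hH φ hφ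
  have hT := isTheory_chiLogic χ Γ
  -- Every valuation in the Lindenbaum–Tarski algebra comes from a substitution, and all instances
  -- of `Γ` are theorems.
  have hmem : HeytAlg.of hT.Lindenbaum ∈ chiVar χ (chiLogic χ Γ) := by
    refine mem_chiVar_chiLogic.mpr fun ψ hψ σ V _ => ?_
    choose t ht using fun p => hT.cls_surjective (V p)
    rw [interp_subst, ← funext ht]
    simp only [hT.interp_cls]
    exact hT.cls_eq_top.mpr (.inst _ hψ)
  rw [← hT.cls_eq_top, ← hT.interp_cls_atom]
  refine hφ _ hmem _ fun p => χ.mem_core.mpr ?_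
  have h := hT.cls_eq_top.mpr (.fixpoint p)
  rwa [← hT.interp_cls_atom, interp_iff_eq_top, UnivariateFormula.interp_app,
    UnivariateFormula.interp_app] at h

theorem chiLog_chiClosure [Infinite α] {C : Set HeytAlg.{u}} (hC : IsVariety C) :
    chiLog χ (chiClosure χ C) = chiLogic χ (logOf α C) := by
  rw [← chiLog_chiVar_chiLogic, chiVar_chiLogic, varOf_logOf hC]

/-- Generators may thus be closed off to a logic, as the deduction theorem below requires. -/
theorem chiLogic_logOf_varOf [Infinite α] (Γ : Set (Formula α)) :
    chiLogic χ (logOf α (varOf Γ : Set HeytAlg.{u})) = chiLogic χ Γ := by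
  rw [← chiLog_chiVar_chiLogic, chiVar_chiLogic, varOf_logOf_varOf, ← chiVar_chiLogic,
    chiLog_chiVar_chiLogic]

/-! ### Meets and joins -/

theorem chiLogic_mono {Γ Δ : Set (Formula α)} (h : Γ ⊆ Δ) : chiLogic χ Γ ⊆ chiLogic χ Δ := by
  intro φ hφ
  induction hφ with
  | ipc h => exact .ipc h
  | inst σ hφ => exact .inst σ (h hφ)
  | fixpoint p => exact .fixpoint p
  | mp _ _ ih₁ ih₂ => exact .mp ih₁ ih₂

/-- Deduction theorem: derivability in `L^χ` reduces to derivability in `L` from a formula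
expressing finitely many fixpoint conditions. -/
theorem exists_imp_mem_of_mem_chiLogic {L : Set (Formula α)} (hL : IsLogic L) {φ : Formula α}
    (h : φ ∈ chiLogic χ L) : ∃ θ ∈ chiLogic χ (∅ : Set (Formula α)), θ.imp φ ∈ L := by
  have of_mem {φ : Formula α} (h : φ ∈ L) :
      ∃ θ ∈ chiLogic χ (∅ : Set (Formula α)), θ.imp φ ∈ L :=
    ⟨bot.imp bot, .ipc (IsTheory.isTheory_ipc.imp_refl bot), hL.imp_of_mem h⟩
  induction h with
  | ipc h => exact of_mem (hL.ipc h)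
  | inst σ hφ => exact of_mem (hL.subst _ σ hφ)
  | fixpoint p => exact ⟨_, .fixpoint p, hL.imp_refl _⟩
  | mp _ _ ih₁ ih₂ =>
    obtain ⟨θ₁, h₁, h₁'⟩ := ih₁
    obtain ⟨θ₂, h₂, h₂'⟩ := ih₂
    have hT := isTheory_chiLogic χ (∅ : Set (Formula α))
    exact ⟨θ₁.and θ₂, hT.mp h₂ (hT.mp h₁ (hT.ipc (.andIntro θ₁ θ₂))),
      hL.imp_mp (hL.imp_trans (hL.ipc (.andLeft _ _)) h₁')
        (hL.imp_trans (hL.ipc (.andRight _ _)) h₂')⟩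

/-- A formula in both has premises θ₁, θ₂ with θ₁ → φ in L₁ and θ₂ → φ in L₂. Then θ₁ ∧ θ₂ → φ is in
both logics, while θ₁ and θ₂ lie in every `χ`-logic. -/
theorem chiLogic_inter {L₁ L₂ : Set (Formula α)} (hL₁ : IsLogic L₁) (hL₂ : IsLogic L₂) :
    chiLogic χ L₁ ∩ chiLogic χ L₂ = chiLogic χ (L₁ ∩ L₂) := by
  refine Set.Subset.antisymm ?_ (Set.subset_inter (chiLogic_mono Set.inter_subset_left)
    (chiLogic_mono Set.inter_subset_right))
  rintro φ ⟨h₁, h₂⟩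
  obtain ⟨θ₁, hθ₁, h₁⟩ := exists_imp_mem_of_mem_chiLogic hL₁ h₁
  obtain ⟨θ₂, hθ₂, h₂⟩ := exists_imp_mem_of_mem_chiLogic hL₂ h₂
  have hT := isTheory_chiLogic χ (L₁ ∩ L₂)
  have hmem : (θ₁.and θ₂).imp φ ∈ L₁ ∩ L₂ :=
    ⟨hL₁.imp_trans (hL₁.ipc (.andLeft _ _)) h₁, hL₂.imp_trans (hL₂.ipc (.andRight _ _)) h₂⟩
  refine hT.mp (hT.mp (chiLogic_mono (Set.empty_subset _) hθ₂)
    (hT.mp (chiLogic_mono (Set.empty_subset _) hθ₁) (hT.ipc (.andIntro θ₁ θ₂)))) ?_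
  -- The identity substitution presents the formula as an instance of itself.
  rw [← subst_atom ((θ₁.and θ₂).imp φ)]
  exact .inst _ hmem

theorem mpClosure_chiLogic_union (Γ₁ Γ₂ : Set (Formula α)) :
    mpClosure (chiLogic χ Γ₁ ∪ chiLogic χ Γ₂) = chiLogic χ (Γ₁ ∪ Γ₂) := by
  apply Set.Subset.antisymm
  · intro φ hφ
    induction hφ with
    | base h =>
      exact h.elim (fun h => chiLogic_mono Set.subset_union_left h)
        fun h => chiLogic_mono Set.subset_union_right h
    | mp _ _ ih₁ ih₂ => exact .mp ih₁ ih₂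
  · intro φ hφ
    induction hφ with
    | ipc h => exact .base (Or.inl (.ipc h))
    | inst σ hφ => exact .base (hφ.imp (.inst σ) (.inst σ))
    | fixpoint p => exact .base (Or.inl (.fixpoint p))
    | mp _ _ ih₁ ih₂ => exact .mp ih₁ ih₂

theorem chiClosure_inter {C₁ C₂ : Set HeytAlg.{v}} (h₁ : IsVariety C₁) (h₂ : IsVariety C₂) :
    IsVariety (C₁ ∩ C₂) ∧ chiClosure χ C₁ ∩ chiClosure χ C₂ = chiClosure χ (C₁ ∩ C₂) := by
  have h : IsVariety (C₁ ∩ C₂) :=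
    { image := fun A B hA hf => ⟨h₁.image A B hA.1 hf, h₂.image A B hA.2 hf⟩
      sub := fun A B hA hf => ⟨h₁.sub A B hA.1 hf, h₂.sub A B hA.2 hf⟩
      prod := fun I A hA => ⟨h₁.prod I A fun i => (hA i).1, h₂.prod I A fun i => (hA i).2⟩ }
  refine ⟨h, Set.ext fun K => ?_⟩
  rw [Set.mem_inter_iff, mem_chiClosure_iff h₁, mem_chiClosure_iff h₂, mem_chiClosure_iff h,
    Set.mem_inter_iff]

/-! ### The collections of `χ`-logics and of `χ`-varieties -/

/-- Classical generators suffice: the two-element algebra validates them, so the logic they generate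
stays classical, and it has the same `χ`-variant. -/
theorem mem_IL_iff [Infinite α] {Λ : Set (Formula α)} :
    Λ ∈ IL α χ ↔ ∃ Γ ⊆ CPC α, Λ = chiLogic χ Γ := by
  constructor
  · rintro ⟨L, hL, rfl⟩
    exact ⟨L, hL.subset_cpc, rfl⟩
  · rintro ⟨Γ, hΓ, rfl⟩
    have h := isLogic_logOf (α := α) (varOf Γ : Set HeytAlg.{u})
    exact ⟨_, ⟨fun φ hφ => h.ipc hφ, logOf_varOf_subset_cpc hΓ, fun φ ψ => h.mp, h.subst⟩,
      (chiLogic_logOf_varOf Γ).symm⟩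

theorem mem_AllChiLogics_of_mem_IL {Λ : Set (Formula α)} :
    Λ ∈ IL α χ → Λ ∈ AllChiLogics α χ := by
  rintro ⟨L, -, rfl⟩
  exact ⟨L, rfl⟩

theorem inter_mem_AllChiLogics [Infinite α] {Λ₁ Λ₂ : Set (Formula α)}
    (h₁ : Λ₁ ∈ AllChiLogics α χ) (h₂ : Λ₂ ∈ AllChiLogics α χ) : Λ₁ ∩ Λ₂ ∈ AllChiLogics α χ := by
  obtain ⟨Γ₁, rfl⟩ := h₁
  obtain ⟨Γ₂, rfl⟩ := h₂
  rw [← chiLogic_logOf_varOf Γ₁, ← chiLogic_logOf_varOf Γ₂,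
    chiLogic_inter (isLogic_logOf _) (isLogic_logOf _)]
  exact ⟨_, rfl⟩

theorem inter_mem_IL [Infinite α] {Λ₁ Λ₂ : Set (Formula α)}
    (h₁ : Λ₁ ∈ IL α χ) (h₂ : Λ₂ ∈ IL α χ) : Λ₁ ∩ Λ₂ ∈ IL α χ := by
  obtain ⟨L₁, h₁, rfl⟩ := h₁
  obtain ⟨L₂, h₂, rfl⟩ := h₂
  rw [mem_IL_iff, chiLogic_inter ⟨⟨fun h => h₁.ipc_subset h, h₁.mp _ _⟩, h₁.subst⟩
    ⟨⟨fun h => h₂.ipc_subset h, h₂.mp _ _⟩, h₂.subst⟩]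
  exact ⟨_, fun φ hφ => h₁.subset_cpc hφ.1, rfl⟩

theorem mpClosure_union_mem_AllChiLogics {Λ₁ Λ₂ : Set (Formula α)}
    (h₁ : Λ₁ ∈ AllChiLogics α χ) (h₂ : Λ₂ ∈ AllChiLogics α χ) :
    mpClosure (Λ₁ ∪ Λ₂) ∈ AllChiLogics α χ := by
  obtain ⟨Γ₁, rfl⟩ := h₁
  obtain ⟨Γ₂, rfl⟩ := h₂
  exact ⟨_, mpClosure_chiLogic_union Γ₁ Γ₂⟩

theorem mpClosure_union_mem_IL [Infinite α] {Λ₁ Λ₂ : Set (Formula α)}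
    (h₁ : Λ₁ ∈ IL α χ) (h₂ : Λ₂ ∈ IL α χ) : mpClosure (Λ₁ ∪ Λ₂) ∈ IL α χ := by
  obtain ⟨Γ₁, hΓ₁, rfl⟩ := mem_IL_iff.mp h₁
  obtain ⟨Γ₂, hΓ₂, rfl⟩ := mem_IL_iff.mp h₂
  exact mem_IL_iff.mpr ⟨_, Set.union_subset hΓ₁ hΓ₂, mpClosure_chiLogic_union Γ₁ Γ₂⟩

theorem mpClosure_union_subset {Λ₁ Λ₂ Λ : Set (Formula α)} (hΛ : Λ ∈ AllChiLogics α χ)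
    (h₁ : Λ₁ ⊆ Λ) (h₂ : Λ₂ ⊆ Λ) : mpClosure (Λ₁ ∪ Λ₂) ⊆ Λ := by
  obtain ⟨Γ, rfl⟩ := hΛ
  intro φ hφ
  induction hφ with
  | base h => exact h.elim (fun h => h₁ h) fun h => h₂ h
  | mp _ _ ih₁ ih₂ => exact .mp ih₁ ih₂

theorem chiVar_mem_AllChiVarieties [Infinite α] {Λ : Set (Formula α)}
    (hΛ : Λ ∈ AllChiLogics α χ) : (chiVar χ Λ : Set HeytAlg.{u}) ∈ AllChiVarieties χ := by
  obtain ⟨Γ, rfl⟩ := hΛ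
  exact ⟨_, isVariety_varOf Γ, chiVar_chiLogic Γ⟩

theorem chiVar_mem_HA [Infinite α] {Λ : Set (Formula α)} (hΛ : Λ ∈ IL α χ) :
    (chiVar χ Λ : Set HeytAlg.{u}) ∈ HA χ := by
  refine ⟨chiVar_mem_AllChiVarieties (mem_AllChiLogics_of_mem_IL hΛ), twoAlg.{u}, ?_, inferInstance⟩
  obtain ⟨Γ, hΓ, rfl⟩ := mem_IL_iff.mp hΛ
  rw [chiVar_chiLogic]
  exact subset_chiClosure χ _ (twoAlg_mem_varOf hΓ)

theorem chiLog_mem_AllChiLogics [Infinite α] {X : Set HeytAlg.{u}}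
    (hX : X ∈ AllChiVarieties χ) : (chiLog χ X : Set (Formula α)) ∈ AllChiLogics α χ := by
  obtain ⟨C, hC, rfl⟩ := hX
  exact ⟨_, chiLog_chiClosure hC⟩

theorem exists_nontrivial_of_mem_HA {C : Set HeytAlg.{u}}
    (hX : chiClosure χ C ∈ HA χ) : ∃ H ∈ C, Nontrivial H := by
  obtain ⟨-, K, ⟨H, hH, f, -⟩, hK⟩ := hX
  refine ⟨H, hH, ⊥, ⊤, fun h => bot_ne_top (α := K) ?_⟩
  rw [← map_bot f, h, map_top]

theorem chiLog_mem_IL [Infinite α] {X : Set HeytAlg.{u}} (hX : X ∈ HA χ) :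
    (chiLog χ X : Set (Formula α)) ∈ IL α χ := by
  obtain ⟨C, hC, rfl⟩ := hX.1
  obtain ⟨H, hH, hH'⟩ := exists_nontrivial_of_mem_HA hX
  exact mem_IL_iff.mpr
    ⟨logOf α C, fun φ hφ => mem_cpc_of_interp_eq_top (hφ H hH), chiLog_chiClosure hC⟩

/-- A common nontrivial member of all nontrivial `χ`-varieties keeps their intersections nontrivial.
-/
theorem twoAlg_mem_of_mem_HA {X : Set HeytAlg.{u}} (hX : X ∈ HA χ) : twoAlg.{u} ∈ X := by
  obtain ⟨C, hC, rfl⟩ := hX.1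
  obtain ⟨H, hH, hH'⟩ := exists_nontrivial_of_mem_HA hX
  exact subset_chiClosure χ C (hC.sub H _ hH (exists_twoAlg_injective H))

theorem inter_mem_AllChiVarieties {X₁ X₂ : Set HeytAlg.{u}}
    (h₁ : X₁ ∈ AllChiVarieties χ) (h₂ : X₂ ∈ AllChiVarieties χ) :
    X₁ ∩ X₂ ∈ AllChiVarieties χ := by
  obtain ⟨C₁, h₁, rfl⟩ := h₁
  obtain ⟨C₂, h₂, rfl⟩ := h₂
  exact ⟨_, chiClosure_inter h₁ h₂⟩

theorem inter_mem_HA {X₁ X₂ : Set HeytAlg.{u}} (h₁ : X₁ ∈ HA χ) (h₂ : X₂ ∈ HA χ) :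
    X₁ ∩ X₂ ∈ HA χ :=
  ⟨inter_mem_AllChiVarieties h₁.1 h₂.1, twoAlg.{u},
    ⟨twoAlg_mem_of_mem_HA h₁, twoAlg_mem_of_mem_HA h₂⟩, inferInstance⟩

theorem chiLog_chiVar {Λ : Set (Formula α)} (hΛ : Λ ∈ AllChiLogics α χ) :
    chiLog χ (chiVar χ Λ : Set HeytAlg.{u}) = Λ := by
  obtain ⟨Γ, rfl⟩ := hΛ
  exact chiLog_chiVar_chiLogic Γ

theorem chiVar_chiLog [Infinite α] {X : Set HeytAlg.{u}} (hX : X ∈ AllChiVarieties χ) :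
    chiVar χ (chiLog χ X : Set (Formula α)) = X := by
  obtain ⟨C, hC, rfl⟩ := hX
  rw [chiLog_chiClosure hC, chiVar_chiLogic, varOf_logOf hC]

theorem chiVar_anti {Λ₁ Λ₂ : Set (Formula α)} (h : Λ₁ ⊆ Λ₂) :
    (chiVar χ Λ₂ : Set HeytAlg.{u}) ⊆ chiVar χ Λ₁ := fun _ hH φ hφ => hH φ (h hφ)

theorem chiLog_anti {X₁ X₂ : Set HeytAlg.{u}} (h : X₁ ⊆ X₂) :
    (chiLog χ X₂ : Set (Formula α)) ⊆ chiLog χ X₁ := fun _ hφ H hH => hφ H (h hH)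

/-! ### The Galois connection as a dual isomorphism -/

section Duality

variable {A : Set (Set (Formula α))} {B : Set (Set HeytAlg.{u})}

theorem exists_dual_orderIso (hA : ∀ Λ ∈ A, chiVar χ Λ ∈ B) (hB : ∀ X ∈ B, chiLog χ X ∈ A)
    (hAB : ∀ Λ ∈ A, chiLog χ (chiVar χ Λ : Set HeytAlg.{u}) = Λ)
    (hBA : ∀ X ∈ B, chiVar χ (chiLog χ X : Set (Formula α)) = X) :
    ∃ e : Aᵒᵈ ≃o B,
      (∀ Λ : A, (e (OrderDual.toDual Λ) : Set HeytAlg.{u}) = chiVar χ (Λ : Set (Formula α))) ∧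
      (∀ X : B, ((OrderDual.ofDual (e.symm X) : A) : Set (Formula α)) =
        chiLog χ (X : Set HeytAlg.{u})) := by
  let e : Aᵒᵈ ≃ B :=
    { toFun := fun Λ => ⟨chiVar χ (OrderDual.ofDual Λ).1, hA _ (OrderDual.ofDual Λ).2⟩
      invFun := fun X => OrderDual.toDual ⟨chiLog χ X.1, hB _ X.2⟩
      left_inv := fun Λ => Subtype.ext (hAB _ (OrderDual.ofDual Λ).2)
      right_inv := fun X => Subtype.ext (hBA _ X.2) }
  refine ⟨⟨e, fun {Λ₁ Λ₂} => ⟨fun h => ?_, fun h => chiVar_anti h⟩⟩, fun _ => rfl, fun _ => rfl⟩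
  have h' := chiLog_anti (α := α) (χ := χ) h
  change chiLog χ (chiVar χ _) ⊆ chiLog χ (chiVar χ _) at h'
  rwa [hAB _ (OrderDual.ofDual Λ₁).2, hAB _ (OrderDual.ofDual Λ₂).2] at h'

/-- Order reversal turns the meet of the two `χ`-logics into the join of the `χ`-varieties. -/
theorem isLeast_chiVar_inter (hA : ∀ Λ ∈ A, chiVar χ Λ ∈ B)
    (hinter : ∀ Λ₁ ∈ A, ∀ Λ₂ ∈ A, Λ₁ ∩ Λ₂ ∈ A) (hB : ∀ X ∈ B, chiLog χ X ∈ A)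
    (hBA : ∀ X ∈ B, chiVar χ (chiLog χ X : Set (Formula α)) = X) {X₁ X₂ : Set HeytAlg.{u}}
    (h₁ : X₁ ∈ B) (h₂ : X₂ ∈ B) :
    IsLeast {X ∈ B | X₁ ⊆ X ∧ X₂ ⊆ X}
      (chiVar χ (chiLog χ X₁ ∩ chiLog χ X₂ : Set (Formula α))) := by
  refine ⟨⟨hA _ (hinter _ (hB _ h₁) _ (hB _ h₂)), fun H hH φ hφ => hφ.1 H hH,
    fun H hH φ hφ => hφ.2 H hH⟩, ?_⟩
  rintro X ⟨hX, hX₁, hX₂⟩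
  rw [← hBA X hX]
  exact chiVar_anti (Set.subset_inter (chiLog_anti hX₁) (chiLog_anti hX₂))

end Duality

theorem isGreatest_inter {β : Type*} {A : Set (Set β)} {s t : Set β} (h : s ∩ t ∈ A) :
    IsGreatest {r ∈ A | r ⊆ s ∧ r ⊆ t} (s ∩ t) :=
  ⟨⟨h, Set.inter_subset_left, Set.inter_subset_right⟩, fun _ hr => Set.subset_inter hr.2.1 hr.2.2⟩

theorem isLeast_mpClosure_union {A : Set (Set (Formula α))} (hA : A ⊆ AllChiLogics α χ)
    {Λ₁ Λ₂ : Set (Formula α)} (h : mpClosure (Λ₁ ∪ Λ₂) ∈ A) :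
    IsLeast {Λ ∈ A | Λ₁ ⊆ Λ ∧ Λ₂ ⊆ Λ} (mpClosure (Λ₁ ∪ Λ₂)) :=
  ⟨⟨h, fun _ hφ => .base (Or.inl hφ), fun _ hφ => .base (Or.inr hφ)⟩,
    fun _ hΛ => mpClosure_union_subset (hA hΛ.1) hΛ.2.1 hΛ.2.2⟩

end ChiLogic

theorem mainTheorem1 {AP : Type u} [Infinite AP] (χ : UnivariateFormula) :
    -- the `χ`-variants of intermediate logics and the nontrivial `χ`-varieties form lattices
    (∀ Λ₁ ∈ IL AP χ, ∀ Λ₂ ∈ IL AP χ,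
      IsGreatest {Λ ∈ IL AP χ | Λ ⊆ Λ₁ ∧ Λ ⊆ Λ₂} (Λ₁ ∩ Λ₂) ∧
      IsLeast {Λ ∈ IL AP χ | Λ₁ ⊆ Λ ∧ Λ₂ ⊆ Λ} (mpClosure (Λ₁ ∪ Λ₂))) ∧
    (∀ X₁ ∈ HA.{u} χ, ∀ X₂ ∈ HA.{u} χ,
      IsGreatest {X ∈ HA.{u} χ | X ⊆ X₁ ∧ X ⊆ X₂} (X₁ ∩ X₂) ∧
      ∃ Y, IsLeast {X ∈ HA.{u} χ | X₁ ⊆ X ∧ X₂ ⊆ X} Y) ∧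
    -- and `Var^χ`, `Log^χ` are mutually inverse dual isomorphisms between them
    (∃ e : (IL AP χ)ᵒᵈ ≃o HA.{u} χ,
      (∀ Λ : IL AP χ, (e (OrderDual.toDual Λ) : Set HeytAlg.{u}) = chiVar χ (Λ : Set (Formula AP))) ∧
      (∀ X : HA.{u} χ, ((OrderDual.ofDual (e.symm X) : IL AP χ) : Set (Formula AP)) =
        chiLog χ (X : Set HeytAlg.{u}))) ∧
    -- the same with the inconsistent logic and the trivial variety included
    (∀ Λ₁ ∈ AllChiLogics AP χ, ∀ Λ₂ ∈ AllChiLogics AP χ,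
      IsGreatest {Λ ∈ AllChiLogics AP χ | Λ ⊆ Λ₁ ∧ Λ ⊆ Λ₂} (Λ₁ ∩ Λ₂) ∧
      IsLeast {Λ ∈ AllChiLogics AP χ | Λ₁ ⊆ Λ ∧ Λ₂ ⊆ Λ} (mpClosure (Λ₁ ∪ Λ₂))) ∧
    (∀ X₁ ∈ AllChiVarieties.{u} χ, ∀ X₂ ∈ AllChiVarieties.{u} χ,
      IsGreatest {X ∈ AllChiVarieties.{u} χ | X ⊆ X₁ ∧ X ⊆ X₂} (X₁ ∩ X₂) ∧
      ∃ Y, IsLeast {X ∈ AllChiVarieties.{u} χ | X₁ ⊆ X ∧ X₂ ⊆ X} Y) ∧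
    (∃ e : (AllChiLogics AP χ)ᵒᵈ ≃o AllChiVarieties.{u} χ,
      (∀ Λ : AllChiLogics AP χ,
        (e (OrderDual.toDual Λ) : Set HeytAlg.{u}) = chiVar χ (Λ : Set (Formula AP))) ∧
      (∀ X : AllChiVarieties.{u} χ,
        ((OrderDual.ofDual (e.symm X) : AllChiLogics AP χ) : Set (Formula AP)) =
          chiLog χ (X : Set HeytAlg.{u}))) := by
  have hIL : IL AP χ ⊆ AllChiLogics AP χ := fun Λ => mem_AllChiLogics_of_mem_IL
  refine ⟨fun Λ₁ h₁ Λ₂ h₂ => ⟨isGreatest_inter (inter_mem_IL h₁ h₂),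
      isLeast_mpClosure_union hIL (mpClosure_union_mem_IL h₁ h₂)⟩,
    fun X₁ h₁ X₂ h₂ => ⟨isGreatest_inter (inter_mem_HA h₁ h₂), _,
      isLeast_chiVar_inter (α := AP) (A := IL AP χ) (fun Λ => chiVar_mem_HA)
        (fun Λ₁ h₁ Λ₂ h₂ => inter_mem_IL h₁ h₂) (fun X => chiLog_mem_IL)
        (fun X hX => chiVar_chiLog hX.1) h₁ h₂⟩,
    exists_dual_orderIso (fun Λ => chiVar_mem_HA) (fun X => chiLog_mem_IL)
      (fun Λ hΛ => chiLog_chiVar (hIL hΛ)) (fun X hX => chiVar_chiLog hX.1),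
    fun Λ₁ h₁ Λ₂ h₂ => ⟨isGreatest_inter (inter_mem_AllChiLogics h₁ h₂),
      isLeast_mpClosure_union Set.Subset.rfl (mpClosure_union_mem_AllChiLogics h₁ h₂)⟩,
    fun X₁ h₁ X₂ h₂ => ⟨isGreatest_inter (inter_mem_AllChiVarieties h₁ h₂), _,
      isLeast_chiVar_inter (α := AP) (A := AllChiLogics AP χ)
        (fun Λ => chiVar_mem_AllChiVarieties)
        (fun Λ₁ h₁ Λ₂ h₂ => inter_mem_AllChiLogics h₁ h₂) (fun X => chiLog_mem_AllChiLogics)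
        (fun X => chiVar_chiLog) h₁ h₂⟩,
    exists_dual_orderIso (fun Λ => chiVar_mem_AllChiVarieties)
      (fun X => chiLog_mem_AllChiLogics) (fun Λ => chiLog_chiVar) (fun X => chiVar_chiLog)⟩
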